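/- Let $k$ be an algebraically closed field of characteristic $p>0$, let $X$ be a connected smooth projective curve over $k$ with function field $K$, and let $|X|$ be the set of closed points of $X$. For a commutative ring $R$ let $W_n(R)$ be the ring of $p$-typical Witt vectors of length $n$; for a sheaf of rings $\mathcal F$ let $\mathscr W_n(\mathcal F)$ be the sheaf $U\mapsto W_n(\mathcal F(U))$, and let $\underline K$ be the constant sheaf with value $K$. Put $$\mathbb A_X=\Big\{(r_{\mathfrak p})\in\prod_{\mathfrak p\in|X|}K \;:\; r_{\mathfrak p}\in\mathcal O_{X,\mathfrak p}\text{ for all but finitely many }\mathfrak p\Big\},\qquad \mathbb A_X^\circ=\prod_{\mathfrak p\in|X|}\mathcal O_{X,\mathfrak p},$$ and embed $K$ diagonally in $\mathbb A_X$. Then for every integer $n\ge 1$ there are isomorphisms of $W_n(k)$-modules $$H^1(X,\mathscr W_n(\mathcal O_X))\;\xrightarrow{\ \varphi\ }\;\frac{\bigoplus_{\mathfrak p\in|X|}W_n(K)/W_n(\mathcal O_{X,\mathfrak p})}{W_n(K)}\;\xrightarrow{\ \psi\ }\;\frac{W_n(\mathbb A_X)}{W_n(\mathbb A_X^\circ)+W_n(K)},$$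 where $H^1$ is Zariski sheaf cohomology and $W_n(K)$ maps diagonally to the direct sum. They are canonical in the following sense. A global section $s$ of the sheaf $\mathscr W_n(\underline K)/\mathscr W_n(\mathcal O_X)$ is said to have principal parts $d=(d_{\mathfrak p})\in\bigoplus_{\mathfrak p}W_n(K)/W_n(\mathcal O_{X,\mathfrak p})$ if, for every $\mathfrak p\in|X|$, the germ of $s$ at $\mathfrak p$ is the germ of the section defined by any $g\in W_n(K)$ in the class $d_{\mathfrak p}$. Every $s$ has principal parts, and every $d$ is the family of principal parts of some $s$. If $s$ has principal parts $d$, then $\varphi(\delta(s))$ is the class of $d$, where $\delta\colon H^0(X,\mathscr W_n(\underline K)/\mathscr W_n(\mathcal O_X))\to H^1(X,\mathscr W_n(\mathcal O_X))$ is the connecting map of the exact sequence $0\to\mathscr W_n(\mathcal O_X)\to\mathscr W_n(\underline K)\to\mathscr W_n(\underline K)/\mathscr W_n(\mathcal O_X)\to0$. For $a\in W_n(\mathbb A_X)$ with components $a_{\mathfrak p}\in W_n(K)$, the map $\psi$ sends the class of $(a_{\mathfrak p}\bmod W_n(\mathcal O_{X,\mathfrak p}))_{\mathfrak p}$ to the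 class of $a$. -/

import Mathlib

universe u
open CategoryTheory TopologicalSpace Opposite AlgebraicGeometry

noncomputable section

namespace WittCurve

/-- The ring homomorphism `W_n(R) → W_n(S)` induced by a ring homomorphism `R → S`. -/
def wittMap (p : ℕ) [Fact p.Prime] (n : ℕ) {R S : Type*} [CommRing R] [CommRing S]
    (φ : R →+* S) : TruncatedWittVector p n R →+* TruncatedWittVector p n S :=
  have key : ∀ y : WittVector p R,
      (TruncatedWittVector.mk p fun i => φ ((WittVector.truncate n y).coeff i)) =
        WittVector.truncate n (WittVector.map φ y) := fun y => by
    ext i; simp [WittVector.map_coeff]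
  have surj := WittVector.truncate_surjective p n R
  { toFun := fun x => TruncatedWittVector.mk p fun i => φ (x.coeff i)
    map_one' := by
      have h := key 1
      simpa only [map_one] using h
    map_zero' := by
      have h := key 0
      simpa only [map_zero] using h
    map_add' := fun x y => by
      obtain ⟨x, rfl⟩ := surj x
      obtain ⟨y, rfl⟩ := surj y
      rw [← map_add, key, key, key, map_add, map_add]
    map_mul' := fun x y => by
      obtain ⟨x, rfl⟩ := surj x
      obtain ⟨y, rfl⟩ := surj y
      rw [← map_mul, key, key, key, map_mul, map_mul] }

@[simp]
lemma coeff_wittMap (p : ℕ) [Fact p.Prime] (n : ℕ) {R S : Type*} [CommRing R] [CommRing S]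
    (φ : R →+* S) (x : TruncatedWittVector p n R) (i : Fin n) :
    (wittMap p n φ x).coeff i = φ (x.coeff i) := rfl

lemma wittMap_wittMap (p : ℕ) [Fact p.Prime] (n : ℕ) {R S T : Type*} [CommRing R] [CommRing S]
    [CommRing T] (φ : R →+* S) (ψ : S →+* T) (x : TruncatedWittVector p n R) :
    wittMap p n ψ (wittMap p n φ x) = wittMap p n (ψ.comp φ) x := rfl

/-- The functor `R ↦ W_n(R)`, remembering the additive group of `W_n(R)`. -/
def wittFunctor (p : ℕ) [Fact p.Prime] (n : ℕ) : CommRingCat.{u} ⥤ AddCommGrpCat.{u} where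
  obj R := AddCommGrpCat.of (TruncatedWittVector p n R)
  map φ := AddCommGrpCat.ofHom (wittMap p n φ.hom).toAddMonoidHom
  map_id _ := rfl
  map_comp _ _ := rfl

lemma wittFunctor_isSheaf (p : ℕ) [Fact p.Prime] (n : ℕ) {X : TopCat.{u}}
    (F : TopCat.Presheaf CommRingCat.{u} X) (hF : F.IsSheaf) :
    TopCat.Presheaf.IsSheaf (F ⋙ wittFunctor p n) := by
  rw [TopCat.Presheaf.isSheaf_iff_isSheafUniqueGluing] at hF ⊢
  intro ι U sf hsf
  have H : ∀ j : Fin n, ∃! s : F.obj (op (iSup U)), TopCat.Presheaf.IsGluing F U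
      (fun i => TruncatedWittVector.coeff j (p := p) (n := n) (R := F.obj (op (U i))) (sf i)) s := by
    intro j
    refine hF U _ fun a b => ?_
    have h := hsf a b
    exact congrArg (TruncatedWittVector.coeff j (p := p) (n := n)
      (R := F.obj (op (U a ⊓ U b)))) h
  choose s hs hu using H
  refine ⟨TruncatedWittVector.mk p s, fun i => ?_, fun t ht => ?_⟩
  · exact TruncatedWittVector.ext (p := p) (n := n) (R := F.obj (op (U i))) fun j => hs j i
  · refine TruncatedWittVector.ext (p := p) (n := n) (R := F.obj (op (iSup U))) fun j =>
      hu j _ fun i => ?_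
    exact congrArg (TruncatedWittVector.coeff j (p := p) (n := n) (R := F.obj (op (U i)))) (ht i)

/-- The sheaf `𝒲_n(ℱ)` of `n`-truncated Witt vectors of a sheaf of rings `ℱ`, as an abelian sheaf:
its sections over `U` are `W_n(ℱ(U))`. -/
def wittSheaf (p : ℕ) [Fact p.Prime] (n : ℕ) {X : TopCat.{u}}
    (F : TopCat.Sheaf CommRingCat.{u} X) :
    Sheaf (Opens.grothendieckTopology X) AddCommGrpCat.{u} :=
  ⟨F.presheaf ⋙ wittFunctor p n, wittFunctor_isSheaf p n F.presheaf F.2⟩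

/-- The morphism `𝒲_n(ℱ) ⟶ 𝒲_n(𝒢)` induced by a morphism of sheaves of rings `ℱ ⟶ 𝒢`. -/
def wittSheafMap (p : ℕ) [Fact p.Prime] (n : ℕ) {X : TopCat.{u}}
    {F G : TopCat.Sheaf CommRingCat.{u} X} (φ : F.presheaf ⟶ G.presheaf) :
    wittSheaf p n F ⟶ wittSheaf p n G :=
  ⟨Functor.whiskerRight φ (wittFunctor p n)⟩

/-- Multiplication by a global section `c` of `𝒲_n(ℱ)`, as an endomorphism of the abelian sheaf
`𝒲_n(ℱ)`. -/
def wittSheafSMul (p : ℕ) [Fact p.Prime] (n : ℕ) {X : TopCat.{u}}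
    (F : TopCat.Sheaf CommRingCat.{u} X) (c : TruncatedWittVector p n (F.presheaf.obj (op ⊤))) :
    wittSheaf p n F ⟶ wittSheaf p n F :=
  ⟨{ app := fun U => AddCommGrpCat.ofHom (AddMonoidHom.mulLeft
        (wittMap p n (F.presheaf.map (homOfLE le_top : U.unop ⟶ ⊤).op).hom c :
          TruncatedWittVector p n (F.presheaf.obj U)))
     naturality := fun U V i => by
      ext x
      have e : wittMap p n (F.presheaf.map (homOfLE le_top : V.unop ⟶ ⊤).op).hom c =
          wittMap p n (F.presheaf.map i).hom
            (wittMap p n (F.presheaf.map (homOfLE le_top : U.unop ⟶ ⊤).op).hom c) := by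
        rw [wittMap_wittMap, ← CommRingCat.hom_comp, ← Functor.map_comp]
        rfl
      let y : TruncatedWittVector p n (F.presheaf.obj U) := x
      change wittMap p n (F.presheaf.map (homOfLE le_top : V.unop ⟶ ⊤).op).hom c *
          wittMap p n (F.presheaf.map i).hom y =
        wittMap p n (F.presheaf.map i).hom
          (wittMap p n (F.presheaf.map (homOfLE le_top : U.unop ⟶ ⊤).op).hom c * y)
      rw [e, map_mul] }⟩

section

variable (p : ℕ) [Fact p.Prime] (n : ℕ) {X : TopCat.{u}} (F : TopCat.Sheaf CommRingCat.{u} X)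

lemma wittSheafSMul_one : wittSheafSMul p n F 1 = 𝟙 _ := by
  ext U x
  let y : TruncatedWittVector p n (F.presheaf.obj U) := x
  change wittMap p n _ 1 * y = y
  rw [map_one, one_mul]

lemma wittSheafSMul_mul (c d : TruncatedWittVector p n (F.presheaf.obj (op ⊤))) :
    wittSheafSMul p n F (c * d) = wittSheafSMul p n F d ≫ wittSheafSMul p n F c := by
  ext U x
  change wittMap p n _ (c * d) * (show TruncatedWittVector p n (F.presheaf.obj U) from x) =
    wittMap p n _ c * (wittMap p n _ d * (show TruncatedWittVector p n (F.presheaf.obj U) from x))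
  rw [map_mul, mul_assoc]

lemma wittSheafSMul_add (c d : TruncatedWittVector p n (F.presheaf.obj (op ⊤))) :
    wittSheafSMul p n F (c + d) = wittSheafSMul p n F c + wittSheafSMul p n F d := by
  ext U x
  change wittMap p n _ (c + d) * (show TruncatedWittVector p n (F.presheaf.obj U) from x) =
    wittMap p n _ c * (show TruncatedWittVector p n (F.presheaf.obj U) from x) +
      wittMap p n _ d * (show TruncatedWittVector p n (F.presheaf.obj U) from x)
  rw [map_add, add_mul]

end

/-- The presheaf of locally constant functions with values in a ring `R`. -/
def constPresheaf (X : TopCat.{u}) (R : Type u) [CommRing R] :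
    TopCat.Presheaf CommRingCat.{u} X where
  obj U := CommRingCat.of (LocallyConstant U.unop R)
  map i := CommRingCat.ofHom (LocallyConstant.comapRingHom
    ⟨Set.inclusion i.unop.le, continuous_inclusion i.unop.le⟩)
  map_id _ := rfl
  map_comp _ _ := rfl

lemma constPresheaf_isSheaf (X : TopCat.{u}) (R : Type u) [CommRing R] :
    (constPresheaf X R).IsSheaf := by
  rw [TopCat.Presheaf.isSheaf_iff_isSheafUniqueGluing]
  intro ι U sf hsf
  let g : ∀ i, LocallyConstant (U i) R := sf
  have hg : ∀ i j x (hi : x ∈ U i) (hj : x ∈ U j), g i ⟨x, hi⟩ = g j ⟨x, hj⟩ := by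
    intro i j x hi hj
    exact congrArg (fun t : LocallyConstant (U i ⊓ U j : Opens X) R => t ⟨x, hi, hj⟩) (hsf i j)
  have hmem : ∀ x : (iSup U : Opens X), ∃ i, x.1 ∈ U i := fun x => Opens.mem_iSup.1 x.2
  choose c hc using hmem
  let G : LocallyConstant (iSup U : Opens X) R := ⟨fun x => g (c x) ⟨x, hc x⟩, by
    rw [IsLocallyConstant.iff_exists_open]
    intro x
    obtain ⟨V, hV, hxV, hVc⟩ :=
      (IsLocallyConstant.iff_exists_open _).1 (g (c x)).isLocallyConstant ⟨x, hc x⟩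
    obtain ⟨W, hW, rfl⟩ := isOpen_induced_iff.1 hV
    refine ⟨Subtype.val ⁻¹' (W ∩ U (c x)),
      (hW.inter (U (c x)).isOpen).preimage continuous_subtype_val, ⟨hxV, hc x⟩, ?_⟩
    intro y hy
    rw [hg _ (c x) y (hc y) hy.2]
    exact hVc ⟨y, hy.2⟩ hy.1⟩
  refine ⟨G, fun i => ?_, fun t ht => ?_⟩
  · refine LocallyConstant.ext (Y := R) (f := _) (g := g i) fun x => ?_
    exact hg _ i x _ x.2
  · refine LocallyConstant.ext (Y := R) (f := t) (g := G) fun x => ?_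
    exact congrArg (fun t : LocallyConstant (U (c x)) R => t ⟨x, hc x⟩) (ht (c x))

/-- The constant sheaf of rings associated with `R`: its sections over `U` are the locally constant
functions `U → R`. -/
def constSheaf (X : TopCat.{u}) (R : Type u) [CommRing R] : TopCat.Sheaf CommRingCat.{u} X :=
  ⟨constPresheaf X R, constPresheaf_isSheaf X R⟩

/-- `W_n(R)` is a `W_n(k)`-algebra when `R` is a `k`-algebra. -/
instance wittAlgebra (p : ℕ) [Fact p.Prime] (n : ℕ) (k R : Type*) [CommRing k] [CommRing R]
    [Algebra k R] : Algebra (TruncatedWittVector p n k) (TruncatedWittVector p n R) :=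
  (wittMap p n (algebraMap k R)).toAlgebra

/-- The `W_n(k)`-linear map `W_n(R) → W_n(S)` induced by a homomorphism `R → S` of
`k`-algebras. -/
def wittMapₗ (p : ℕ) [Fact p.Prime] (n : ℕ) {k R S : Type*} [CommRing k] [CommRing R]
    [CommRing S] [Algebra k R] [Algebra k S] (φ : R →ₐ[k] S) :
    TruncatedWittVector p n R →ₗ[TruncatedWittVector p n k] TruncatedWittVector p n S where
  toFun := wittMap p n φ.toRingHom
  map_add' := map_add _
  map_smul' c x := by
    have h : wittMap p n φ.toRingHom (wittMap p n (algebraMap k R) c) =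
        wittMap p n (algebraMap k S) c := by
      rw [wittMap_wittMap, AlgHom.toRingHom_eq_coe, AlgHom.comp_algebraMap]
    change wittMap p n φ.toRingHom (wittMap p n (algebraMap k R) c * x) =
      wittMap p n (algebraMap k S) c * wittMap p n φ.toRingHom x
    rw [map_mul, h]

/-- `W_n(A)` as a `W_n(k)`-submodule of `W_n(R)`, for a `k`-subalgebra `A` of `R`. -/
def wittSubmodule (p : ℕ) [Fact p.Prime] (n : ℕ) {k R : Type*} [CommRing k] [CommRing R]
    [Algebra k R] (A : Subalgebra k R) :
    Submodule (TruncatedWittVector p n k) (TruncatedWittVector p n R) :=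
  LinearMap.range (wittMapₗ p n A.val)

lemma mem_wittSubmodule (p : ℕ) [Fact p.Prime] (n : ℕ) {k R : Type*} [CommRing k] [CommRing R]
    [Algebra k R] (A : Subalgebra k R) (x : TruncatedWittVector p n R) :
    x ∈ wittSubmodule p n A ↔ ∀ i, x.coeff i ∈ A := by
  constructor
  · rintro ⟨y, rfl⟩ i
    exact (y.coeff i).2
  · intro h
    exact ⟨TruncatedWittVector.mk p fun i => ⟨x.coeff i, h i⟩, rfl⟩

/-- A connected smooth proper curve over `k`: an integral scheme of dimension one, smooth and
proper over `k`. (Over a field, such a curve is projective; a smooth `k`-scheme that is connected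
is integral.) -/
structure Curve (k : Type u) [Field k] where
  /-- the underlying scheme -/
  X : Scheme.{u}
  /-- the structure morphism -/
  f : X ⟶ Spec (.of k)
  isIntegral : IsIntegral X
  smooth : Smooth f
  isProper : IsProper f
  dim_eq_one : topologicalKrullDim X = 1

namespace Curve

variable {k : Type u} [Field k] (C : Curve k)

instance : IsIntegral C.X := C.isIntegral
instance : Smooth C.f := C.smooth
instance : IsProper C.f := C.isProper

instance : IsNoetherian C.X :=
  have : IsLocallyNoetherian C.X := LocallyOfFiniteType.isLocallyNoetherian C.f
  have : CompactSpace C.X := 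
    (quasiCompact_iff_compactSpace (f := C.f)).1 inferInstance
  {}

/-- The structure homomorphism `k → Γ(X, 𝒪_X)`. -/
def toGlobal : k →+* Γ(C.X, ⊤) :=
  ((Scheme.ΓSpecIso (.of k)).inv ≫ C.f.appTop).hom

/-- The function field of the curve. -/
abbrev K : Type u := C.X.functionField

instance : Algebra k C.K :=
  ((C.X.presheaf.germ ⊤ (genericPoint C.X) trivial).hom.comp C.toGlobal).toAlgebra

/-- The local ring `𝒪_{X,x}` as a subalgebra of the function field. -/
def localRing (x : C.X) : Subalgebra k C.K where
  __ := (algebraMap (C.X.presheaf.stalk x) C.K).range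
  algebraMap_mem' c := ⟨C.X.presheaf.germ ⊤ x (Opens.mem_top x) (C.toGlobal c),
    have : Nonempty (⊤ : C.X.Opens) := ⟨⟨x, Opens.mem_top x⟩⟩
    Scheme.algebraMap_germ_eq_germToFunctionField (X := C.X) (Opens.mem_top x) (C.toGlobal c)⟩

lemma mem_localRing (x : C.X) (a : C.K) :
    a ∈ C.localRing x ↔ a ∈ (algebraMap (C.X.presheaf.stalk x) C.K).range := Iff.rfl

lemma finite_closedPoints_of_isClosed (Z : Set C.X) (hZ : IsClosed Z) (hZ' : Z ≠ Set.univ) :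
    {x : closedPoints C.X | x.1 ∈ Z}.Finite := by
  obtain ⟨S, hS, hSc, hSi, rfl⟩ :=
    TopologicalSpace.NoetherianSpace.exists_finite_set_isClosed_irreducible hZ
  have key : ∀ x : closedPoints C.X, ∀ t ∈ S, x.1 ∈ t → t = {x.1} := by
    intro x t ht hx
    by_contra hne
    let a : IrreducibleCloseds C.X := ⟨{x.1}, isIrreducible_singleton, x.2⟩
    let b : IrreducibleCloseds C.X := ⟨t, hSi t ht, hSc t ht⟩
    let c : IrreducibleCloseds C.X := ⟨Set.univ, IrreducibleSpace.isIrreducible_univ _,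
      isClosed_univ⟩
    have hab : a < b := lt_of_le_of_ne (Set.singleton_subset_iff.2 hx) fun h =>
      hne (congrArg (fun z : IrreducibleCloseds C.X => (z : Set C.X)) h).symm
    have hbc : b < c := lt_of_le_of_ne (Set.subset_univ _) fun h => by
      have h' : t = Set.univ := congrArg (fun z : IrreducibleCloseds C.X => (z : Set C.X)) h
      exact hZ' (Set.eq_univ_of_univ_subset (h' ▸ Set.subset_sUnion_of_mem ht))
    have := Order.LTSeries.length_le_krullDim
      (⟨2, ![a, b, c], by simp [Fin.forall_fin_two, hab, hbc]⟩ :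
        LTSeries (IrreducibleCloseds C.X))
    have hd := C.dim_eq_one
    rw [topologicalKrullDim] at hd
    rw [hd] at this
    have h21 : (2 : WithBot ℕ∞) ≤ 1 := this
    exact absurd h21 (by decide)
  refine Set.Finite.of_finite_image (f := fun x : closedPoints C.X => ({x.1} : Set C.X))
    (hS.subset ?_) ?_
  · rintro _ ⟨x, ⟨t, ht, hx⟩, rfl⟩
    have h := key x t ht hx
    change {x.1} ∈ S
    exact h ▸ ht
  · intro x _ y _ h
    exact Subtype.ext (Set.singleton_injective h)

/-- A rational function is regular at all but finitely many closed points. -/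
lemma finite_poles (a : C.K) : {x : closedPoints C.X | a ∉ C.localRing x}.Finite := by
  obtain ⟨U, hU, s, rfl⟩ := C.X.presheaf.exists_germ_eq a
  refine (C.finite_closedPoints_of_isClosed (U : Set C.X)ᶜ U.isOpen.isClosed_compl ?_).subset ?_
  · intro h
    have : genericPoint C.X ∈ ((U : Set C.X)ᶜ) := h ▸ Set.mem_univ _
    exact this hU
  · intro x hx hxU
    refine hx ⟨C.X.presheaf.germ U x hxU s, ?_⟩
    have : Nonempty U := ⟨⟨x, hxU⟩⟩
    rw [Scheme.algebraMap_germ_eq_germToFunctionField]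

/-- The ring of adeles: families of rational functions indexed by the closed points, regular at
all but finitely many of them. -/
def Adele : Subalgebra k (closedPoints C.X → C.K) where
  carrier := {r | {x : closedPoints C.X | r x ∉ C.localRing x}.Finite}
  mul_mem' {r s} hr hs := (hr.union hs).subset fun x hx => by
    by_contra h
    simp only [Set.mem_union, Set.mem_ofPred_eq, not_or, not_not] at h
    exact hx (mul_mem h.1 h.2)
  add_mem' {r s} hr hs := (hr.union hs).subset fun x hx => by
    by_contra h
    simp only [Set.mem_union, Set.mem_ofPred_eq, not_or, not_not] at h
    exact hx (add_mem h.1 h.2)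
  algebraMap_mem' c :=
    Set.finite_empty.subset fun x hx => hx ((C.localRing x).algebraMap_mem c)

/-- The subring of everywhere regular adeles. -/
def regularAdele : Subalgebra k C.Adele where
  carrier := {r | ∀ x : closedPoints C.X, r.1 x ∈ C.localRing x}
  mul_mem' hr hs x := mul_mem (hr x) (hs x)
  add_mem' hr hs x := add_mem (hr x) (hs x)
  algebraMap_mem' c x := (C.localRing x).algebraMap_mem c

/-- The diagonal embedding of the function field into the adeles. -/
def diag : C.K →ₐ[k] C.Adele where
  toFun a := ⟨fun _ => a, C.finite_poles a⟩
  map_one' := rfl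
  map_mul' _ _ := rfl
  map_zero' := rfl
  map_add' _ _ := rfl
  commutes' _ := rfl

/-- The component of an adele at a closed point. -/
def component (x : closedPoints C.X) : C.Adele →ₐ[k] C.K :=
  (Pi.evalAlgHom k (fun _ => C.K) x).comp C.Adele.val

variable (p : ℕ) [Fact p.Prime] (n : ℕ)

/-- The quotient `W_n(𝔸) / (W_n(𝔸°) + W_n(K))`. -/
abbrev AdelicQuotient : Type u :=
  TruncatedWittVector p n C.Adele ⧸
    (wittSubmodule p n C.regularAdele ⊔ LinearMap.range (wittMapₗ p n C.diag))

/-- The module `W_n(K) / W_n(𝒪_{X,x})`. -/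
def LocalQuotient (x : C.X) : Type u :=
  TruncatedWittVector p n C.K ⧸ wittSubmodule p n (C.localRing x)

instance (x : C.X) : AddCommGroup (C.LocalQuotient p n x) :=
  inferInstanceAs (AddCommGroup (TruncatedWittVector p n C.K ⧸ wittSubmodule p n (C.localRing x)))

instance (x : C.X) : Module (TruncatedWittVector p n k) (C.LocalQuotient p n x) :=
  inferInstanceAs (Module (TruncatedWittVector p n k)
    (TruncatedWittVector p n C.K ⧸ wittSubmodule p n (C.localRing x)))

/-- The quotient map `W_n(K) → W_n(K) / W_n(𝒪_{X,x})`. -/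
def toLocalQuotient (x : C.X) :
    TruncatedWittVector p n C.K →ₗ[TruncatedWittVector p n k] C.LocalQuotient p n x :=
  (wittSubmodule p n (C.localRing x)).mkQ

lemma toLocalQuotient_eq_zero_iff (x : C.X) (g : TruncatedWittVector p n C.K) :
    C.toLocalQuotient p n x g = 0 ↔ g ∈ wittSubmodule p n (C.localRing x) :=
  Submodule.Quotient.mk_eq_zero _

/-- The module `⨁ₓ W_n(K) / W_n(𝒪_{X,x})`, over the closed points `x` of the curve. -/
abbrev PrincipalParts : Type u :=
  DirectSum (closedPoints C.X) fun x => C.LocalQuotient p n x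

lemma finite_poles_witt (a : TruncatedWittVector p n C.Adele) :
    {x : closedPoints C.X |
      wittMapₗ p n (C.component x) a ∉ wittSubmodule p n (C.localRing x)}.Finite := by
  refine (Set.finite_iUnion fun i : Fin n => (a.coeff i).2).subset fun x hx => ?_
  rw [Set.mem_ofPred_eq, mem_wittSubmodule, not_forall] at hx
  exact Set.mem_iUnion.2 hx

open Classical in
/-- The family of the classes in `W_n(K) / W_n(𝒪_{X,x})` of the components `aₓ ∈ W_n(K)` of
`a ∈ W_n(𝔸)`. -/
def principalPartsFun (a : TruncatedWittVector p n C.Adele) : C.PrincipalParts p n :=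
  DirectSum.mk (fun x : closedPoints C.X => C.LocalQuotient p n x)
    (C.finite_poles_witt p n a).toFinset
    fun x => C.toLocalQuotient p n x.1 (wittMapₗ p n (C.component x.1) a)

lemma principalPartsFun_apply (a : TruncatedWittVector p n C.Adele) (x : closedPoints C.X) :
    C.principalPartsFun p n a x = C.toLocalQuotient p n x (wittMapₗ p n (C.component x) a) := by
  classical
  by_cases hx : x ∈ (C.finite_poles_witt p n a).toFinset
  · exact DirectSum.mk_apply_of_mem hx
  · rw [principalPartsFun, DirectSum.mk_apply_of_notMem hx, eq_comm, toLocalQuotient_eq_zero_iff]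
    simpa using hx

/-- The map `W_n(𝔸) → ⨁ₓ W_n(K) / W_n(𝒪_{X,x})` that sends `a` to the family of the classes of its
components `aₓ ∈ W_n(K)`. -/
def principalParts : TruncatedWittVector p n C.Adele →ₗ[TruncatedWittVector p n k]
    C.PrincipalParts p n where
  toFun := C.principalPartsFun p n
  map_add' a b := by
    refine DFinsupp.ext fun x => ?_
    refine (C.principalPartsFun_apply p n _ x).trans ?_
    rw [map_add, map_add]
    exact (congrArg₂ (· + ·) (C.principalPartsFun_apply p n a x)
      (C.principalPartsFun_apply p n b x)).symm
  map_smul' c a := by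
    refine DFinsupp.ext fun x => ?_
    refine (C.principalPartsFun_apply p n _ x).trans ?_
    rw [map_smul, map_smul]
    exact (congrArg (c • ·) (C.principalPartsFun_apply p n a x)).symm

lemma principalParts_apply (a : TruncatedWittVector p n C.Adele) (x : closedPoints C.X) :
    C.principalParts p n a x = C.toLocalQuotient p n x (wittMapₗ p n (C.component x) a) :=
  C.principalPartsFun_apply p n a x

/-- The map `W_n(K) → ⨁ₓ W_n(K) / W_n(𝒪_{X,x})` that sends `g` to the family of the classes
of `g`. -/
def diagPrincipalParts : TruncatedWittVector p n C.K →ₗ[TruncatedWittVector p n k]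
    C.PrincipalParts p n :=
  C.principalParts p n ∘ₗ wittMapₗ p n C.diag

lemma diagPrincipalParts_apply (g : TruncatedWittVector p n C.K) (x : closedPoints C.X) :
    C.diagPrincipalParts p n g x = C.toLocalQuotient p n x g :=
  C.principalParts_apply p n _ x

/-- The quotient `(⨁ₓ W_n(K) / W_n(𝒪_{X,x})) / W_n(K)`. -/
abbrev PrincipalPartsQuotient : Type u :=
  C.PrincipalParts p n ⧸ LinearMap.range (C.diagPrincipalParts p n)

/-- The sheaf `𝒲_n(𝒪_X)`. -/
abbrev wittO : Sheaf (Opens.grothendieckTopology C.X) AddCommGrpCat.{u} :=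
  wittSheaf p n C.X.sheaf

/-- The cohomology group `H¹(X, 𝒲_n(𝒪_X))`. -/
def H1 : Type u := (C.wittO p n).H 1

instance : AddCommGroup (C.H1 p n) := inferInstanceAs (AddCommGroup ((C.wittO p n).H 1))

/-- Multiplication by `c ∈ W_n(k)` on `𝒲_n(𝒪_X)`. -/
def wittOSMul (c : TruncatedWittVector p n k) : C.wittO p n ⟶ C.wittO p n :=
  wittSheafSMul p n C.X.sheaf (wittMap p n C.toGlobal c)

lemma wittOSMul_one : C.wittOSMul p n 1 = 𝟙 _ :=
  (congrArg (wittSheafSMul p n C.X.sheaf) (map_one (wittMap p n C.toGlobal))).trans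
    (wittSheafSMul_one p n C.X.sheaf)

lemma wittOSMul_mul (c d : TruncatedWittVector p n k) :
    C.wittOSMul p n (c * d) = C.wittOSMul p n d ≫ C.wittOSMul p n c :=
  (congrArg (wittSheafSMul p n C.X.sheaf) (map_mul (wittMap p n C.toGlobal) c d)).trans
    (wittSheafSMul_mul p n C.X.sheaf _ _)

lemma wittOSMul_add (c d : TruncatedWittVector p n k) :
    C.wittOSMul p n (c + d) = C.wittOSMul p n c + C.wittOSMul p n d :=
  (congrArg (wittSheafSMul p n C.X.sheaf) (map_add (wittMap p n C.toGlobal) c d)).trans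
    (wittSheafSMul_add p n C.X.sheaf _ _)

/-- `H¹(X, 𝒲_n(𝒪_X))` is a `W_n(k)`-module by functoriality of cohomology: `c ∈ W_n(k)` acts by
the map induced by the multiplication by `c` on `𝒲_n(𝒪_X)`. -/
instance : Module (TruncatedWittVector p n k) (C.H1 p n) where
  smul c h := Sheaf.H.map (C.wittOSMul p n c) 1 h
  one_smul h :=
    (congrArg (fun a => Sheaf.H.map a 1 h) (C.wittOSMul_one p n)).trans (Sheaf.H.map_id_apply _)
  mul_smul c d h :=
    (congrArg (fun a => Sheaf.H.map a 1 h) (C.wittOSMul_mul p n c d)).trans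
      (Sheaf.H.map_comp_apply _ _ _)
  smul_zero c := map_zero (Sheaf.H.map (C.wittOSMul p n c) 1)
  smul_add c := map_add (Sheaf.H.map (C.wittOSMul p n c) 1)
  add_smul c d h :=
    (congrArg (fun a => Sheaf.H.map a 1 h) (C.wittOSMul_add p n c d)).trans
      (Sheaf.H.map_add_apply _ _ _)
  zero_smul h := by
    have e : Sheaf.H.map (C.wittOSMul p n (0 + 0)) 1 h =
        Sheaf.H.map (C.wittOSMul p n 0) 1 h + Sheaf.H.map (C.wittOSMul p n 0) 1 h :=
      (congrArg (fun a => Sheaf.H.map a 1 h) (C.wittOSMul_add p n 0 0)).trans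
        (Sheaf.H.map_add_apply _ _ _)
    rw [add_zero] at e
    exact left_eq_add.1 e

/-- The sheaf `𝒲_n(K)`, for the constant sheaf of rings associated with the function field. -/
abbrev wittK : Sheaf (Opens.grothendieckTopology C.X) AddCommGrpCat.{u} :=
  wittSheaf p n (constSheaf C.X C.K)

/-- The inclusion of `𝒪_X` into the constant sheaf of rings `K`. -/
def toConst : C.X.sheaf.presheaf ⟶ (constSheaf C.X C.K).presheaf where
  app U := CommRingCat.ofHom
    { toFun := fun s => (⟨fun x => C.X.presheaf.germ U.unop (genericPoint C.X)
          (((genericPoint_spec C.X).mem_open_set_iff U.unop.isOpen).2 ⟨x.1, trivial, x.2⟩) s,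
          IsLocallyConstant.of_constant _ fun _ _ => rfl⟩ : LocallyConstant U.unop C.K)
      map_one' := LocallyConstant.ext fun _ =>
        map_one (C.X.presheaf.germ U.unop (genericPoint C.X) _).hom
      map_zero' := LocallyConstant.ext fun _ =>
        map_zero (C.X.presheaf.germ U.unop (genericPoint C.X) _).hom
      map_mul' := fun s t => LocallyConstant.ext fun _ =>
        map_mul (C.X.presheaf.germ U.unop (genericPoint C.X) _).hom s t
      map_add' := fun s t => LocallyConstant.ext fun _ =>
        map_add (C.X.presheaf.germ U.unop (genericPoint C.X) _).hom s t }
  naturality U V i := by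
    ext s
    refine LocallyConstant.ext (Y := C.K) fun x => ?_
    exact C.X.presheaf.germ_res_apply i.unop _ _ s

/-- The inclusion `𝒲_n(𝒪_X) ⟶ 𝒲_n(K)`. -/
def wittIncl : C.wittO p n ⟶ C.wittK p n := wittSheafMap p n C.toConst

lemma toConst_injective (U : C.X.Opens) :
    Function.Injective (C.toConst.app (op U)).hom := by
  intro s t h
  by_cases hU : Nonempty U
  · obtain ⟨x⟩ := hU
    have e : ∀ s : Γ(C.X, U), (show LocallyConstant U C.K from (C.toConst.app (op U)).hom s) x =
        C.X.presheaf.germ U (genericPoint C.X)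
          (((genericPoint_spec C.X).mem_open_set_iff U.isOpen).2 ⟨x.1, trivial, x.2⟩) s :=
      fun _ => rfl
    exact germ_injective_of_isIntegral (X := C.X) (genericPoint C.X) _
      ((e s).symm.trans ((congrArg (fun a : LocallyConstant U C.K => a x) h).trans (e t)))
  · have : U = ⊥ := by
      ext x
      exact ⟨fun hx => hU ⟨⟨x, hx⟩⟩, fun hx => hx.elim⟩
    subst this
    exact Subsingleton.elim (α := Γ(C.X, ⊥)) s t

instance : Mono (C.wittIncl p n) := by
  refine Sheaf.mono_of_injective _ fun U x y h => ?_
  refine TruncatedWittVector.ext (p := p) (n := n) (R := C.X.presheaf.obj U) fun i => ?_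
  exact C.toConst_injective U.unop (congrArg (TruncatedWittVector.coeff i (p := p) (n := n)
    (R := LocallyConstant U.unop C.K)) h)

/-- The short complex `𝒲_n(𝒪_X) ⟶ 𝒲_n(K) ⟶ 𝒲_n(K)/𝒲_n(𝒪_X)` of abelian sheaves. -/
def wittComplex : ShortComplex (Sheaf (Opens.grothendieckTopology C.X) AddCommGrpCat.{u}) :=
  ShortComplex.mk (C.wittIncl p n) (Limits.cokernel.π (C.wittIncl p n))
    (Limits.cokernel.condition _)

lemma wittComplex_shortExact : (C.wittComplex p n).ShortExact where
  exact := ShortComplex.exact_cokernel _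
  mono_f := inferInstanceAs (Mono (C.wittIncl p n))
  epi_g := inferInstanceAs (Epi (Limits.cokernel.π (C.wittIncl p n)))

/-- The quotient sheaf `𝒲_n(K)/𝒲_n(𝒪_X)`. -/
abbrev wittQ : Sheaf (Opens.grothendieckTopology C.X) AddCommGrpCat.{u} := (C.wittComplex p n).X₃

/-- The connecting homomorphism `Γ(X, 𝒲_n(K)/𝒲_n(𝒪_X)) → H¹(X, 𝒲_n(𝒪_X))`. -/
def connecting (s : (C.wittQ p n).obj.obj (op ⊤)) : C.H1 p n :=
  ((Sheaf.H.equiv₀ (C.wittQ p n) Limits.isTerminalTop).symm s).comp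
    (C.wittComplex_shortExact p n).extClass (zero_add 1)

/-- The global section of `𝒲_n(K)/𝒲_n(𝒪_X)` given by `g ∈ W_n(K)`. -/
def globalSection (g : TruncatedWittVector p n C.K) : (C.wittQ p n).obj.obj (op ⊤) :=
  (C.wittComplex p n).g.hom.app (op ⊤)
    (wittMap p n (LocallyConstant.constRingHom : C.K →+* LocallyConstant (⊤ : Opens C.X) C.K) g)

/-- The global section `s` of `𝒲_n(K)/𝒲_n(𝒪_X)` has `d` as its family of principal parts: for
every closed point `x` and every `g ∈ W_n(K)` in the class `dₓ`, the germs at `x` of `s` and of the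
section given by `g` coincide. -/
def HasPrincipalParts (s : (C.wittQ p n).obj.obj (op ⊤)) (d : C.PrincipalParts p n) : Prop :=
  ∀ (x : closedPoints C.X) (g : TruncatedWittVector p n C.K), d x = C.toLocalQuotient p n x g →
    TopCat.Presheaf.germ (C.wittQ p n).obj ⊤ x.1 trivial s =
      TopCat.Presheaf.germ (C.wittQ p n).obj ⊤ x.1 trivial (C.globalSection p n g)

end Curve

end WittCurve

end

noncomputable section

/-! The curve is irreducible, so locally constant functions on nonempty opens are constant. Hence
$\mathscr W_n(\underline K)$ is flasque with global sections $W_n(K)$, and its $H^1$ vanishes. The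
long exact sequence of $0\to\mathscr W_n(\mathcal O_X)\to\mathscr W_n(\underline K)\to\mathscr
Q\to0$ then identifies $H^1(X,\mathscr W_n(\mathcal O_X))$ with $\Gamma(X,\mathscr Q)/W_n(K)$
(`connecting_surjective`, `connecting_eq_zero_iff`).

Global sections of $\mathscr Q$ are the same as principal parts. The germ at $x$ of the section
given by $g$ vanishes exactly when $g\in W_n(\mathcal O_{X,x})$ (`germ_globalSection_eq_zero_iff`),
and there is no condition at the generic point. As the dimension is one, a proper closed subset has
finitely many closed points. So a section has finite support (`exists_hasPrincipalParts_right`), and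
any finitely supported family can be glued from sections on complements of finite sets
(`exists_hasPrincipalParts_left`). The connecting map respects the $W_n(k)$-action because
multiplication by a scalar is an endomorphism of the whole exact sequence.

The adelic form is algebra: taking principal parts maps $W_n(\mathbb A_X)$ onto the direct sum with
kernel $W_n(\mathbb A_X^\circ)$. Although Witt vector addition is not componentwise, membership in
$W_n$ of a subring is, so regularity is checked on each of the $n$ components. -/

/-- A flasque sheaf has no first cohomology. -/
lemma TopCat.Sheaf.IsFlasque.subsingleton_H_one {X : TopCat.{u}}
    (F : CategoryTheory.Sheaf (Opens.grothendieckTopology X) AddCommGrpCat.{u})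
    (hF : TopCat.Sheaf.IsFlasque F) : Subsingleton (F.H 1) := by
  let S : ShortComplex (CategoryTheory.Sheaf (Opens.grothendieckTopology X) AddCommGrpCat.{u}) :=
    ShortComplex.mk (Injective.ι F) (Limits.cokernel.π (Injective.ι F))
      (Limits.cokernel.condition _)
  have hS : S.ShortExact :=
    { exact := ShortComplex.exact_cokernel _
      mono_f := inferInstanceAs (Mono (Injective.ι F))
      epi_g := inferInstanceAs (Epi (Limits.cokernel.π (Injective.ι F))) }
  refine subsingleton_of_forall_eq 0 fun x => ?_
  have : Injective S.X₂ := inferInstanceAs (Injective (Injective.under F))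
  -- The class dies in $H^1$ of the injective sheaf, so it comes from a global section `y` of the
  -- quotient; flasqueness of `F` lifts `y` to the injective sheaf, and the image of a lifted
  -- section under the connecting map is zero.
  obtain ⟨y, rfl⟩ := Abelian.Ext.covariant_sequence_exact₁ _ hS x
    (Abelian.Ext.eq_zero_of_injective _) (zero_add 1)
  have : TopCat.Sheaf.IsFlasque S.X₁ := hF
  obtain ⟨t, ht⟩ := (AddCommGrpCat.epi_iff_surjective _).1
    (TopCat.Sheaf.IsFlasque.epi_of_shortExact (S := S) (U := ⊤) hS)
    (CategoryTheory.Sheaf.H.equiv₀ S.X₃ Limits.isTerminalTop y)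
  have hy : y = CategoryTheory.Sheaf.H.map S.g 0
      ((CategoryTheory.Sheaf.H.equiv₀ S.X₂ Limits.isTerminalTop).symm t) := by
    rw [CategoryTheory.Sheaf.H.equiv₀_symm_naturality, ht, AddEquiv.symm_apply_apply]
  rw [hy, CategoryTheory.Sheaf.H.map_apply, Abelian.Ext.comp_assoc_of_second_deg_zero,
    hS.comp_extClass, Abelian.Ext.comp_zero]

namespace WittCurve

namespace Curve

variable {k : Type u} [Field k] (C : Curve k)

/-! ### Points and open subsets of the curve -/

lemma genericPoint_mem {U : C.X.Opens} {x : C.X} (hx : x ∈ U) : genericPoint C.X ∈ U :=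
  ((genericPoint_spec C.X).mem_open_set_iff U.isOpen).2 ⟨x, trivial, hx⟩

/-- A point of a curve is closed or the generic point. -/
lemma isClosed_singleton_or_eq_genericPoint (x : C.X) :
    IsClosed {x} ∨ x = genericPoint C.X := by
  by_contra! h
  obtain ⟨h₁, h₂⟩ := h
  -- If `x` were neither closed nor generic, a closed point `y` in its closure would give a chain
  -- $\{y\}\subsetneq\overline{\{x\}}\subsetneq X$ of length two.
  obtain ⟨y, hy, hyc⟩ := IsClosed.exists_closed_singleton (S := closure {x}) isClosed_closure
    (Set.singleton_nonempty x).closure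
  let a : IrreducibleCloseds C.X := ⟨{y}, isIrreducible_singleton, hyc⟩
  let b : IrreducibleCloseds C.X := ⟨closure {x}, isIrreducible_singleton.closure, isClosed_closure⟩
  let c : IrreducibleCloseds C.X := ⟨Set.univ, IrreducibleSpace.isIrreducible_univ _,
    isClosed_univ⟩
  have hab : a < b := lt_of_le_of_ne (Set.singleton_subset_iff.2 hy) fun h => by
    have h' : {y} = closure {x} := congrArg (fun z : IrreducibleCloseds C.X => (z : Set C.X)) h
    have hxy : x = y := by
      have : x ∈ closure {x} := subset_closure rfl
      rwa [← h'] at this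
    subst hxy
    exact h₁ hyc
  have hbc : b < c := lt_of_le_of_ne (Set.subset_univ _) fun h => by
    have h' : closure {x} = Set.univ :=
      congrArg (fun z : IrreducibleCloseds C.X => (z : Set C.X)) h
    exact h₂ ((genericPoint_spec C.X).eq (show IsGenericPoint x ⊤ from h')).symm
  have := Order.LTSeries.length_le_krullDim
    (⟨2, ![a, b, c], by simp [Fin.forall_fin_two, hab, hbc]⟩ :
      LTSeries (IrreducibleCloseds C.X))
  have hd := C.dim_eq_one
  rw [topologicalKrullDim] at hd
  rw [hd] at this
  have h21 : (2 : WithBot ℕ∞) ≤ 1 := this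
  exact absurd h21 (by decide)

instance : Nonempty (closedPoints C.X) := by
  obtain ⟨y, -, hyc⟩ := IsClosed.exists_closed_singleton (S := (Set.univ : Set C.X)) isClosed_univ
    Set.univ_nonempty
  exact ⟨⟨y, hyc⟩⟩

/-- The complement of a finite set of closed points. -/
def complOpens (S : Set (closedPoints C.X)) (hS : S.Finite) : C.X.Opens :=
  ⟨(Subtype.val '' S)ᶜ, by
    rw [isOpen_compl_iff, ← Set.biUnion_of_singleton (Subtype.val '' S)]
    refine (hS.image _).isClosed_biUnion ?_
    rintro _ ⟨x, -, rfl⟩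
    exact x.2⟩

lemma mem_complOpens {S : Set (closedPoints C.X)} {hS : S.Finite} (x : closedPoints C.X) :
    x.1 ∈ C.complOpens S hS ↔ x ∉ S := by
  exact not_congr Subtype.val_injective.mem_set_image

/-! ### Sections and germs of the quotient sheaf -/

variable (p : ℕ) [Fact p.Prime] (n : ℕ)

/-- The constant section of `𝒲_n(K)` with value `g`. -/
def constSection (U : C.X.Opens) (g : TruncatedWittVector p n C.K) :
    (C.wittK p n).obj.obj (op U) :=
  wittMap p n (LocallyConstant.constRingHom : C.K →+* LocallyConstant U C.K) g

/-- A nonempty open subset of an irreducible space is connected, so each Witt component is constant;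
its value can be read off at any point. -/
lemma exists_constSection_eq {U : C.X.Opens} (hU : (U : Set C.X).Nonempty)
    (s : (C.wittK p n).obj.obj (op U)) : ∃ g, C.constSection p n U g = s := by
  obtain ⟨x, hx⟩ := hU
  let t : TruncatedWittVector p n (LocallyConstant U C.K) := s
  refine ⟨TruncatedWittVector.mk p fun i => t.coeff i ⟨x, hx⟩, ?_⟩
  refine TruncatedWittVector.ext (p := p) (n := n) (R := LocallyConstant U C.K) fun i => ?_
  refine LocallyConstant.ext fun y => ?_
  have : PreconnectedSpace U := by
    refine Subtype.preconnectedSpace ?_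
    exact ((PreirreducibleSpace.isPreirreducible_univ (X := C.X)).open_subset U.isOpen
      (Set.subset_univ _)).isPreconnected
  exact (t.coeff i).isLocallyConstant.apply_eq_of_isPreconnected isPreconnected_univ trivial trivial

/-- The section of `𝒲_n(K)/𝒲_n(𝒪_X)` over `U` given by `g ∈ W_n(K)`. -/
def quotSection (U : C.X.Opens) : TruncatedWittVector p n C.K →+ (C.wittQ p n).obj.obj (op U) :=
  ((C.wittComplex p n).g.hom.app (op U)).hom.comp
    (wittMap p n (LocallyConstant.constRingHom : C.K →+* LocallyConstant U C.K)).toAddMonoidHom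

lemma quotSection_apply (U : C.X.Opens) (g : TruncatedWittVector p n C.K) :
    C.quotSection p n U g = (C.wittComplex p n).g.hom.app (op U) (C.constSection p n U g) := rfl

lemma quotSection_top (g : TruncatedWittVector p n C.K) :
    C.quotSection p n ⊤ g = C.globalSection p n g := rfl

lemma map_quotSection {U V : C.X.Opens} (i : V ⟶ U) (g : TruncatedWittVector p n C.K) :
    (C.wittQ p n).obj.map i.op (C.quotSection p n U g) = C.quotSection p n V g := by
  have := ConcreteCategory.congr_hom ((C.wittComplex p n).g.hom.naturality i.op)
    (C.constSection p n U g)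
  exact this.symm

lemma germ_quotSection (U : C.X.Opens) (x : C.X) (hx : x ∈ U) (g : TruncatedWittVector p n C.K) :
    TopCat.Presheaf.germ (C.wittQ p n).obj U x hx (C.quotSection p n U g) =
      TopCat.Presheaf.germ (C.wittQ p n).obj ⊤ x trivial (C.globalSection p n g) := by
  rw [← quotSection_top, ← C.map_quotSection p n (homOfLE le_top : U ⟶ ⊤)]
  exact TopCat.Presheaf.germ_res_apply _ _ _ _ _

/-- Each of the finitely many Witt components extends to a regular function near `x`; on the
intersection of these neighbourhoods `g` comes from $\mathscr W_n(\mathcal O_X)$. -/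
lemma quotSection_of_mem {x : C.X} {g : TruncatedWittVector p n C.K}
    (hg : g ∈ wittSubmodule p n (C.localRing x)) :
    ∃ U : C.X.Opens, x ∈ U ∧ C.quotSection p n U g = 0 := by
  rw [mem_wittSubmodule] at hg
  have : ∀ i, ∃ (U : C.X.Opens) (hx : x ∈ U) (s : Γ(C.X, U)),
      C.X.presheaf.germ U (genericPoint C.X) (C.genericPoint_mem hx) s = g.coeff i := by
    intro i
    obtain ⟨t, ht⟩ := hg i
    obtain ⟨U, hU, s, rfl⟩ := C.X.presheaf.exists_germ_eq t
    have : Nonempty U := ⟨⟨x, hU⟩⟩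
    refine ⟨U, hU, s, ?_⟩
    rw [← ht]
    exact (Scheme.algebraMap_germ_eq_germToFunctionField (X := C.X) hU s).symm
  choose U hx s hs using this
  let V : C.X.Opens := ⟨⋂ i, U i, isOpen_iInter_of_finite fun i => (U i).isOpen⟩
  have hV : x ∈ V := Set.mem_iInter.2 hx
  have hVU : ∀ i, V ≤ U i := fun i => Set.iInter_subset _ i
  refine ⟨V, hV, ?_⟩
  let t : (C.wittO p n).obj.obj (op V) :=
    (TruncatedWittVector.mk p fun i => C.X.presheaf.map (homOfLE (hVU i)).op (s i) :
      TruncatedWittVector p n Γ(C.X, V))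
  have ht : (C.wittIncl p n).hom.app (op V) t = C.constSection p n V g := by
    refine TruncatedWittVector.ext (p := p) (n := n) (R := LocallyConstant V C.K) fun i => ?_
    refine LocallyConstant.ext fun y => ?_
    refine Eq.trans ?_ (hs i)
    exact C.X.presheaf.germ_res_apply (homOfLE (hVU i)) _ (C.genericPoint_mem hV) (s i)
  rw [quotSection_apply, ← ht]
  have h0 := ConcreteCategory.congr_hom (congrArg (fun f => f.hom.app (op V))
    (C.wittComplex p n).zero) t
  exact h0

/-- By left exactness of sections, `g` lifts to a Witt vector over $\mathcal O_X(U)$, whose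
components have germs at `x`. -/
lemma mem_of_quotSection {U : C.X.Opens} {g : TruncatedWittVector p n C.K}
    (hg : C.quotSection p n U g = 0) {x : C.X} (hx : x ∈ U) :
    g ∈ wittSubmodule p n (C.localRing x) := by
  obtain ⟨t, ht⟩ := TopCat.Sheaf.sections_exact_of_left_exact (S := C.wittComplex p n)
    (C.wittComplex_shortExact p n).exact (C.wittComplex_shortExact p n).mono_f
    (C.constSection p n U g) hg
  rw [mem_wittSubmodule]
  intro i
  let t' : TruncatedWittVector p n Γ(C.X, U) := t
  have : Nonempty U := ⟨⟨x, hx⟩⟩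
  refine ⟨C.X.presheaf.germ U x hx (t'.coeff i), ?_⟩
  refine (Scheme.algebraMap_germ_eq_germToFunctionField (X := C.X) hx (t'.coeff i)).trans ?_
  exact congrArg (fun a : TruncatedWittVector p n (LocallyConstant U C.K) => a.coeff i ⟨x, hx⟩) ht

/-- This makes $W_n(K)/W_n(\mathcal O_{X,x})$ embed in the stalk of the quotient sheaf at `x`. -/
lemma germ_globalSection_eq_zero_iff (x : C.X) (g : TruncatedWittVector p n C.K) :
    TopCat.Presheaf.germ (C.wittQ p n).obj ⊤ x trivial (C.globalSection p n g) = 0 ↔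
      g ∈ wittSubmodule p n (C.localRing x) := by
  constructor
  · intro h
    rw [← map_zero (TopCat.Presheaf.germ (C.wittQ p n).obj ⊤ x trivial).hom] at h
    obtain ⟨W, hxW, i₁, i₂, h⟩ := TopCat.Presheaf.germ_eq _ x _ _ _ _ h
    refine C.mem_of_quotSection p n (U := W) ?_ hxW
    rw [← C.map_quotSection p n i₁]
    exact h.trans (map_zero _)
  · intro h
    obtain ⟨U, hx, hU⟩ := C.quotSection_of_mem p n h
    rw [← C.germ_quotSection p n U x hx, hU]
    exact map_zero _

lemma germ_globalSection_eq_iff (x : C.X) (g h : TruncatedWittVector p n C.K) :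
    TopCat.Presheaf.germ (C.wittQ p n).obj ⊤ x trivial (C.globalSection p n g) =
        TopCat.Presheaf.germ (C.wittQ p n).obj ⊤ x trivial (C.globalSection p n h) ↔
      C.toLocalQuotient p n x g = C.toLocalQuotient p n x h := by
  rw [← sub_eq_zero (b := C.toLocalQuotient p n x h), ← map_sub,
    C.toLocalQuotient_eq_zero_iff p n x, ← germ_globalSection_eq_zero_iff]
  have e : TopCat.Presheaf.germ (C.wittQ p n).obj ⊤ x trivial (C.globalSection p n (g - h)) =
      TopCat.Presheaf.germ (C.wittQ p n).obj ⊤ x trivial (C.globalSection p n g) -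
        TopCat.Presheaf.germ (C.wittQ p n).obj ⊤ x trivial (C.globalSection p n h) :=
    (congrArg (TopCat.Presheaf.germ (C.wittQ p n).obj ⊤ x trivial)
      (map_sub (C.quotSection p n ⊤) g h)).trans
      (map_sub (TopCat.Presheaf.germ (C.wittQ p n).obj ⊤ x trivial).hom _ _)
  rw [e, sub_eq_zero]

/-! ### Global sections of the quotient sheaf and principal parts -/

lemma toLocalQuotient_surjective (x : C.X) : Function.Surjective (C.toLocalQuotient p n x) :=
  Submodule.mkQ_surjective _

lemma exists_principalParts_apply_eq (f : ∀ x : closedPoints C.X, C.LocalQuotient p n x.1)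
    (hf : {x | f x ≠ 0}.Finite) : ∃ d : C.PrincipalParts p n, ∀ x, d x = f x := by
  classical
  refine ⟨DirectSum.mk (fun x : closedPoints C.X => C.LocalQuotient p n x) hf.toFinset
    fun x => f x.1, fun x => ?_⟩
  by_cases hx : x ∈ hf.toFinset
  · exact DirectSum.mk_apply_of_mem hx
  · rw [DirectSum.mk_apply_of_notMem hx]
    simpa [eq_comm] using hx

lemma finite_support (d : C.PrincipalParts p n) : {x | d x ≠ 0}.Finite := by
  classical
  refine (DFinsupp.support d).finite_toSet.subset fun x hx => ?_
  exact DFinsupp.mem_support_iff.2 hx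

lemma finite_toLocalQuotient_ne_zero (g : TruncatedWittVector p n C.K) :
    {x : closedPoints C.X | C.toLocalQuotient p n x.1 g ≠ 0}.Finite := by
  refine (C.finite_support p n (C.diagPrincipalParts p n g)).subset fun x hx => ?_
  rw [Set.mem_ofPred_eq, diagPrincipalParts_apply]
  exact hx

variable {C p n}

/-- One representative at each point suffices, since two representatives of the same class have the
same germ. -/
lemma hasPrincipalParts_iff {s : (C.wittQ p n).obj.obj (op ⊤)} {d : C.PrincipalParts p n} :
    C.HasPrincipalParts p n s d ↔ ∀ x : closedPoints C.X, ∃ g : TruncatedWittVector p n C.K,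
      d x = C.toLocalQuotient p n x g ∧ TopCat.Presheaf.germ (C.wittQ p n).obj ⊤ x.1 trivial s =
        TopCat.Presheaf.germ (C.wittQ p n).obj ⊤ x.1 trivial (C.globalSection p n g) := by
  constructor
  · intro h x
    obtain ⟨g, hg⟩ := C.toLocalQuotient_surjective p n x.1 (d x)
    exact ⟨g, hg.symm, h x g hg.symm⟩
  · intro h x g hg
    obtain ⟨g', hg', e⟩ := h x
    rw [e, germ_globalSection_eq_iff, ← hg, ← hg']

/-- An epimorphism of sheaves is locally surjective, and local sections of $\mathscr W_n(\underline
K)$ are constant. -/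
lemma exists_quotSection_eq (s : (C.wittQ p n).obj.obj (op ⊤)) (x : C.X) :
    ∃ (U : C.X.Opens) (_ : x ∈ U) (g : TruncatedWittVector p n C.K),
      C.quotSection p n U g = (C.wittQ p n).obj.map (homOfLE le_top : U ⟶ ⊤).op s := by
  have : Epi (C.wittComplex p n).g := (C.wittComplex_shortExact p n).epi_g
  obtain ⟨U, _, ⟨t, ht⟩, hx⟩ := (TopCat.Presheaf.isLocallySurjective_iff _).1
    ((TopCat.Sheaf.isLocallySurjective_iff_epi (C.wittComplex p n).g).2 this) ⊤ s x trivial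
  obtain ⟨g, rfl⟩ := C.exists_constSection_eq p n ⟨x, hx⟩ t
  exact ⟨U, hx, g, ht⟩

lemma germ_eq_of_quotSection_eq {s : (C.wittQ p n).obj.obj (op ⊤)} {U : C.X.Opens}
    {g : TruncatedWittVector p n C.K}
    (h : C.quotSection p n U g = (C.wittQ p n).obj.map (homOfLE le_top : U ⟶ ⊤).op s)
    {x : C.X} (hx : x ∈ U) :
    TopCat.Presheaf.germ (C.wittQ p n).obj ⊤ x trivial s =
      TopCat.Presheaf.germ (C.wittQ p n).obj ⊤ x trivial (C.globalSection p n g) := by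
  rw [← C.germ_quotSection p n U x hx, h]
  exact (TopCat.Presheaf.germ_res_apply _ _ _ _ _).symm

lemma exists_hasPrincipalParts_right (s : (C.wittQ p n).obj.obj (op ⊤)) :
    ∃ d : C.PrincipalParts p n, C.HasPrincipalParts p n s d := by
  choose U hU g hg using exists_quotSection_eq s
  obtain ⟨d, hd⟩ := C.exists_principalParts_apply_eq p n
    (fun x => C.toLocalQuotient p n x.1 (g x)) (by
      -- Finite support: near the generic point `s` is given by a single `g η`. A closed point in
      -- the support lies either outside that neighbourhood or at a pole of `g η`, which leaves
      -- finitely many.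
      let η := genericPoint C.X
      refine ((C.finite_closedPoints_of_isClosed (U η : Set C.X)ᶜ (U η).isOpen.isClosed_compl
        fun h => (h ▸ Set.mem_univ η : η ∈ (U η : Set C.X)ᶜ) (hU η)).union
        (C.finite_toLocalQuotient_ne_zero p n (g η))).subset fun x hx => ?_
      by_cases hxU : x.1 ∈ U η
      · refine Or.inr fun h0 => hx ?_
        rw [← h0, ← germ_globalSection_eq_iff, ← germ_eq_of_quotSection_eq (hg _) (hU _),
          ← germ_eq_of_quotSection_eq (hg _) hxU]
      · exact Or.inl hxU)
  exact ⟨d, hasPrincipalParts_iff.2 fun x =>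
    ⟨g x, hd x, germ_eq_of_quotSection_eq (hg _) (hU _)⟩⟩

lemma HasPrincipalParts.right_unique {s : (C.wittQ p n).obj.obj (op ⊤)}
    {d d' : C.PrincipalParts p n} (h : C.HasPrincipalParts p n s d)
    (h' : C.HasPrincipalParts p n s d') : d = d' := by
  refine DFinsupp.ext fun x => ?_
  obtain ⟨g, hg, e⟩ := hasPrincipalParts_iff.1 h x
  obtain ⟨g', hg', e'⟩ := hasPrincipalParts_iff.1 h' x
  exact hg.trans (((C.germ_globalSection_eq_iff p n x g g').1 (e.symm.trans e')).trans hg'.symm)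

lemma HasPrincipalParts.left_unique {s s' : (C.wittQ p n).obj.obj (op ⊤)}
    {d : C.PrincipalParts p n} (h : C.HasPrincipalParts p n s d)
    (h' : C.HasPrincipalParts p n s' d) : s = s' := by
  have key (x : closedPoints C.X) :
      TopCat.Presheaf.germ (C.wittQ p n).obj ⊤ x.1 trivial s =
        TopCat.Presheaf.germ (C.wittQ p n).obj ⊤ x.1 trivial s' := by
    obtain ⟨g, hg⟩ := C.toLocalQuotient_surjective p n x.1 (d x)
    exact (h x g hg.symm).trans (h' x g hg.symm).symm
  refine TopCat.Presheaf.section_ext (C.wittQ p n) ⊤ s s' fun y hy => ?_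
  obtain hy' | rfl := C.isClosed_singleton_or_eq_genericPoint y
  · exact key ⟨y, hy'⟩
  -- Sections agreeing at a closed point agree on a neighbourhood, which contains the generic point.
  · obtain ⟨x⟩ := (inferInstance : Nonempty (closedPoints C.X))
    obtain ⟨W, hxW, i₁, i₂, e⟩ := TopCat.Presheaf.germ_eq (C.wittQ p n).obj x.1 _ _ s s' (key x)
    exact (TopCat.Presheaf.germ_res_apply _ i₁ _ (C.genericPoint_mem hxW) s).symm.trans
      ((congrArg _ e).trans (TopCat.Presheaf.germ_res_apply _ i₂ _ (C.genericPoint_mem hxW) s'))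

variable (C) in
lemma mem_localRing_genericPoint (a : C.K) : a ∈ C.localRing (genericPoint C.X) := by
  obtain ⟨U, hU, s, rfl⟩ := C.X.presheaf.exists_germ_eq a
  have : Nonempty U := ⟨⟨_, hU⟩⟩
  exact ⟨C.X.presheaf.germ U _ hU s, Scheme.algebraMap_germ_eq_germToFunctionField (X := C.X) hU s⟩

/-- Vanishing is tested on germs, and the generic point contributes nothing because its local ring
is all of `K`. -/
lemma quotSection_eq_zero {U : C.X.Opens} {g : TruncatedWittVector p n C.K}
    (h : ∀ x : closedPoints C.X, x.1 ∈ U → C.toLocalQuotient p n x.1 g = 0) :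
    C.quotSection p n U g = 0 := by
  refine TopCat.Presheaf.section_ext (C.wittQ p n) U _ _ fun y hy => ?_
  refine (C.germ_quotSection p n U y hy g).trans (Eq.trans ?_
    (map_zero (TopCat.Presheaf.germ (C.wittQ p n).obj U y hy).hom).symm)
  rw [germ_globalSection_eq_zero_iff]
  obtain hy' | rfl := C.isClosed_singleton_or_eq_genericPoint y
  · exact (C.toLocalQuotient_eq_zero_iff p n y g).1 (h ⟨y, hy'⟩ hy)
  · exact (mem_wittSubmodule p n _ _).2 fun i => C.mem_localRing_genericPoint _

lemma exists_hasPrincipalParts_left (d : C.PrincipalParts p n) :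
    ∃ s : (C.wittQ p n).obj.obj (op ⊤), C.HasPrincipalParts p n s d := by
  choose g hg using fun x : closedPoints C.X => C.toLocalQuotient_surjective p n x.1 (d x)
  -- `V x` omits every point other than `x` where `d` is nonzero or where `g x` has a pole. Thus `g
  -- x` has principal parts `d` on all of `V x`.
  let S (x : closedPoints C.X) : Set (closedPoints C.X) :=
    ({y | d y ≠ 0} ∪ {y | C.toLocalQuotient p n y.1 (g x) ≠ 0}) \ {x}
  have hS (x) : (S x).Finite :=
    ((C.finite_support p n d).union (C.finite_toLocalQuotient_ne_zero p n (g x))).sdiff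
  let V (x) : C.X.Opens := C.complOpens (S x) (hS x)
  have hxV (x) : x.1 ∈ V x := (C.mem_complOpens x).2 fun h => h.2 rfl
  have hreg {x y : closedPoints C.X} (hy : y.1 ∈ V x) (h : x ≠ y ∨ d y = 0) :
      C.toLocalQuotient p n y.1 (g x) = 0 := by
    by_cases hxy : x = y
    · subst hxy
      rw [hg, h.resolve_left fun h => h rfl]
    · by_contra h0
      exact (C.mem_complOpens y).1 hy ⟨Or.inr h0, Ne.symm hxy⟩
  have hsupp {x y : closedPoints C.X} (hy : y.1 ∈ V x) (h : x ≠ y) : d y = 0 := by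
    by_contra h0
    exact (C.mem_complOpens y).1 hy ⟨Or.inl h0, h.symm⟩
  have hcover : (⊤ : C.X.Opens) ≤ iSup V := by
    intro y _
    rw [Opens.mem_iSup]
    obtain hy | rfl := C.isClosed_singleton_or_eq_genericPoint y
    · exact ⟨⟨y, hy⟩, hxV _⟩
    · obtain ⟨x⟩ := (inferInstance : Nonempty (closedPoints C.X))
      exact ⟨x, C.genericPoint_mem (hxV x)⟩
  have hcomp : TopCat.Presheaf.IsCompatible (C.wittQ p n).obj V
      fun x => C.quotSection p n (V x) (g x) := by
    intro x y
    refine (C.map_quotSection p n _ _).trans (Eq.trans ?_ (C.map_quotSection p n _ _).symm)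
    rw [← sub_eq_zero, ← map_sub]
    by_cases hxy : x = y
    · rw [hxy, sub_self, map_zero]
    refine quotSection_eq_zero fun z hz => ?_
    -- A point of the overlap differs from `x` or from `y`, so `d` vanishes there; both `g x` and `g
    -- y` are then regular at it.
    have hz' : d z = 0 := by
      by_cases hxz : x = z
      · exact hsupp hz.2 fun h => hxy (hxz.trans h.symm)
      · exact hsupp hz.1 hxz
    rw [map_sub, hreg hz.1 (Or.inr hz'), hreg hz.2 (Or.inr hz'), sub_zero]
  obtain ⟨s, hs, -⟩ := TopCat.Sheaf.existsUnique_gluing' (C.wittQ p n) V ⊤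
    (fun x => homOfLE le_top) hcover _ hcomp
  exact ⟨s, hasPrincipalParts_iff.2 fun x =>
    ⟨g x, (hg x).symm, germ_eq_of_quotSection_eq (hs x).symm (hxV x)⟩⟩

lemma hasPrincipalParts_globalSection (g : TruncatedWittVector p n C.K) :
    C.HasPrincipalParts p n (C.globalSection p n g) (C.diagPrincipalParts p n g) :=
  hasPrincipalParts_iff.2 fun x => ⟨g, C.diagPrincipalParts_apply p n g x, rfl⟩

lemma HasPrincipalParts.add {s s' : (C.wittQ p n).obj.obj (op ⊤)} {d d' : C.PrincipalParts p n}
    (h : C.HasPrincipalParts p n s d) (h' : C.HasPrincipalParts p n s' d') :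
    C.HasPrincipalParts p n (s + s') (d + d') := by
  rw [hasPrincipalParts_iff] at *
  intro x
  obtain ⟨g, hg, e⟩ := h x
  obtain ⟨g', hg', e'⟩ := h' x
  refine ⟨g + g', ?_, ?_⟩
  · rw [map_add, ← hg, ← hg']
    rfl
  · refine (map_add (TopCat.Presheaf.germ (C.wittQ p n).obj ⊤ x.1 trivial).hom s s').trans
      ((congrArg₂ (· + ·) e e').trans ?_)
    refine (map_add (TopCat.Presheaf.germ (C.wittQ p n).obj ⊤ x.1 trivial).hom _ _).symm.trans ?_
    exact congrArg _ (map_add (C.quotSection p n ⊤) g g').symm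

/-! ### Compatibility with multiplication by `W_n(k)` -/

variable (C p n)

/-- Multiplication by `c ∈ W_n(k)` on `𝒲_n(K)`. -/
def wittKSMul (c : TruncatedWittVector p n k) : C.wittK p n ⟶ C.wittK p n :=
  wittSheafSMul p n (constSheaf C.X C.K)
    (wittMap p n (LocallyConstant.constRingHom : C.K →+* LocallyConstant (⊤ : Opens C.X) C.K)
      (wittMap p n (algebraMap k C.K) c))

lemma wittOSMul_comp_wittIncl (c : TruncatedWittVector p n k) :
    C.wittOSMul p n c ≫ C.wittIncl p n = C.wittIncl p n ≫ C.wittKSMul p n c := by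
  ext U x
  let y : TruncatedWittVector p n (C.X.presheaf.obj U) := x
  let f : C.X.presheaf.obj U →+* LocallyConstant U.unop C.K := (C.toConst.app U).hom
  refine (map_mul (wittMap p n f)
    (wittMap p n (C.X.presheaf.map (homOfLE le_top : U.unop ⟶ ⊤).op).hom
      (wittMap p n C.toGlobal c)) y).trans ?_
  refine congrArg (· * wittMap p n f y) ?_
  refine TruncatedWittVector.ext (p := p) (n := n) (R := LocallyConstant U.unop C.K) fun i => ?_
  refine LocallyConstant.ext fun z => ?_
  exact C.X.presheaf.germ_res_apply (homOfLE le_top : U.unop ⟶ ⊤) _ (C.genericPoint_mem z.2)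
    (C.toGlobal (c.coeff i))

/-- Multiplication by `c ∈ W_n(k)` on the complex `𝒲_n(𝒪_X) ⟶ 𝒲_n(K) ⟶ 𝒲_n(K)/𝒲_n(𝒪_X)`. -/
def wittComplexSMul (c : TruncatedWittVector p n k) : C.wittComplex p n ⟶ C.wittComplex p n where
  τ₁ := C.wittOSMul p n c
  τ₂ := C.wittKSMul p n c
  τ₃ := Limits.cokernel.map _ _ _ _ (C.wittOSMul_comp_wittIncl p n c).symm
  comm₁₂ := C.wittOSMul_comp_wittIncl p n c
  comm₂₃ := (Limits.cokernel.π_desc _ _ _).symm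

lemma wittComplexSMul_globalSection (c : TruncatedWittVector p n k)
    (g : TruncatedWittVector p n C.K) :
    (C.wittComplexSMul p n c).τ₃.hom.app (op ⊤) (C.globalSection p n g) =
      C.globalSection p n (c • g) := by
  have h := ConcreteCategory.congr_hom (congrArg (fun f => f.hom.app (op ⊤))
    (C.wittComplexSMul p n c).comm₂₃) (C.constSection p n ⊤ g)
  refine h.symm.trans (congrArg ((C.wittComplex p n).g.hom.app (op ⊤)) ?_)
  exact (map_mul (wittMap p n (LocallyConstant.constRingHom :
    C.K →+* LocallyConstant (⊤ : Opens C.X) C.K)) (wittMap p n (algebraMap k C.K) c) g).symm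

variable {C p n}

lemma HasPrincipalParts.smul {s : (C.wittQ p n).obj.obj (op ⊤)} {d : C.PrincipalParts p n}
    (h : C.HasPrincipalParts p n s d) (c : TruncatedWittVector p n k) :
    C.HasPrincipalParts p n ((C.wittComplexSMul p n c).τ₃.hom.app (op ⊤) s) (c • d) := by
  rw [hasPrincipalParts_iff] at *
  intro x
  obtain ⟨g, hg, e⟩ := h x
  refine ⟨c • g, ?_, ?_⟩
  · rw [map_smul, ← hg]
    rfl
  -- A sheaf endomorphism acts on stalks, so the equality of germs of `s` and of the section given
  -- by `g` is preserved.
  · have key (t : (C.wittQ p n).obj.obj (op ⊤)) :=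
      TopCat.Presheaf.stalkFunctor_map_germ_apply ⊤ x.1 trivial
        (C.wittComplexSMul p n c).τ₃.hom t
    rw [← wittComplexSMul_globalSection]
    exact (key s).symm.trans ((congrArg _ e).trans (key _))

/-! ### The connecting homomorphism -/

variable (C p n)

lemma isFlasque_wittK : TopCat.Sheaf.IsFlasque (C.wittK p n) where
  epi {U V} i := by
    rw [AddCommGrpCat.epi_iff_surjective]
    intro s
    by_cases hV : (V.unop : Set C.X).Nonempty
    · obtain ⟨g, rfl⟩ := C.exists_constSection_eq p n hV s
      exact ⟨C.constSection p n U.unop g, rfl⟩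
    · refine ⟨0, ?_⟩
      refine TruncatedWittVector.ext (p := p) (n := n) (R := LocallyConstant V.unop C.K) fun i => ?_
      exact LocallyConstant.ext fun x => (hV ⟨x.1, x.2⟩).elim

lemma connecting_add (s t : (C.wittQ p n).obj.obj (op ⊤)) :
    C.connecting p n (s + t) = C.connecting p n s + C.connecting p n t := by
  unfold connecting
  rw [map_add]
  exact Abelian.Ext.add_comp _ _ _ _

/-- Scalars act on $H^1$ by functoriality, so linearity is the naturality of the extension class
under the endomorphism `wittComplexSMul` of the exact sequence. -/
lemma connecting_smul (c : TruncatedWittVector p n k) (s : (C.wittQ p n).obj.obj (op ⊤)) :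
    C.connecting p n ((C.wittComplexSMul p n c).τ₃.hom.app (op ⊤) s) = c • C.connecting p n s := by
  have h := ShortComplex.ShortExact.extClass_naturality (C.wittComplex_shortExact p n)
    (C.wittComplex_shortExact p n) (C.wittComplexSMul p n c)
  unfold connecting
  rw [← Sheaf.H.equiv₀_symm_naturality, Sheaf.H.map_apply,
    Abelian.Ext.comp_assoc_of_second_deg_zero, ← h]
  exact (Abelian.Ext.comp_assoc_of_third_deg_zero _ _ _ _).symm

/-- The next term of the long exact sequence is $H^1$ of the flasque sheaf $\mathscr W_n(\underline
K)$, which is zero. -/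
lemma connecting_surjective : Function.Surjective (C.connecting p n) := by
  intro x
  have hsub := TopCat.Sheaf.IsFlasque.subsingleton_H_one (C.wittK p n) (C.isFlasque_wittK p n)
  obtain ⟨y, rfl⟩ := Abelian.Ext.covariant_sequence_exact₁ _ (C.wittComplex_shortExact p n) x
    (hsub.elim _ _) (zero_add 1)
  refine ⟨Sheaf.H.equiv₀ (C.wittQ p n) Limits.isTerminalTop y, ?_⟩
  unfold connecting
  rw [AddEquiv.symm_apply_apply]

/-- Exactness at $H^0$ of the quotient: the kernel consists of the images of global sections of
$\mathscr W_n(\underline K)$, all of which are constant. -/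
lemma connecting_eq_zero_iff (s : (C.wittQ p n).obj.obj (op ⊤)) :
    C.connecting p n s = 0 ↔ ∃ g, C.globalSection p n g = s := by
  constructor
  · intro h
    obtain ⟨y, hy⟩ := Abelian.Ext.covariant_sequence_exact₃ _ (C.wittComplex_shortExact p n)
      ((Sheaf.H.equiv₀ (C.wittQ p n) Limits.isTerminalTop).symm s) (zero_add 1) h
    obtain ⟨g, hg⟩ := C.exists_constSection_eq p n (U := ⊤) Set.univ_nonempty
      (Sheaf.H.equiv₀ (C.wittK p n) Limits.isTerminalTop y)
    refine ⟨g, ?_⟩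
    rw [AddEquiv.eq_symm_apply] at hy
    rw [← hy]
    refine Eq.trans ?_ (Sheaf.H.equiv₀_naturality Limits.isTerminalTop (C.wittComplex p n).g y)
    exact congrArg ((C.wittComplex p n).g.hom.app (op ⊤)) hg
  · rintro ⟨g, rfl⟩
    have h := Sheaf.H.equiv₀_symm_naturality Limits.isTerminalTop (C.wittComplex p n).g
      (C.constSection p n ⊤ g)
    have e : (Sheaf.H.equiv₀ (C.wittQ p n) Limits.isTerminalTop).symm (C.globalSection p n g) =
      _ := h.symm
    unfold connecting
    rw [e, Sheaf.H.map_apply, Abelian.Ext.comp_assoc_of_second_deg_zero,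
      (C.wittComplex_shortExact p n).comp_extClass, Abelian.Ext.comp_zero]
    rfl

/-! ### The isomorphism with `H¹` -/

/-- The global section of `𝒲_n(K)/𝒲_n(𝒪_X)` with given principal parts. -/
def ofPrincipalParts (d : C.PrincipalParts p n) : (C.wittQ p n).obj.obj (op ⊤) :=
  (exists_hasPrincipalParts_left d).choose

lemma hasPrincipalParts_ofPrincipalParts (d : C.PrincipalParts p n) :
    C.HasPrincipalParts p n (C.ofPrincipalParts p n d) d :=
  (exists_hasPrincipalParts_left d).choose_spec

variable {C p n} in
lemma HasPrincipalParts.ofPrincipalParts_eq {s : (C.wittQ p n).obj.obj (op ⊤)}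
    {d : C.PrincipalParts p n} (h : C.HasPrincipalParts p n s d) : C.ofPrincipalParts p n d = s :=
  (C.hasPrincipalParts_ofPrincipalParts p n d).left_unique h

/-- The map `⨁ₓ W_n(K) / W_n(𝒪_{X,x}) → H¹(X, 𝒲_n(𝒪_X))` induced by the connecting
homomorphism. -/
def principalPartsToH1 : C.PrincipalParts p n →ₗ[TruncatedWittVector p n k] C.H1 p n where
  toFun d := C.connecting p n (C.ofPrincipalParts p n d)
  map_add' d d' := by
    rw [← connecting_add, ((C.hasPrincipalParts_ofPrincipalParts p n d).add
      (C.hasPrincipalParts_ofPrincipalParts p n d')).ofPrincipalParts_eq]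
  map_smul' c d := by
    rw [RingHom.id_apply, ← connecting_smul,
      ((C.hasPrincipalParts_ofPrincipalParts p n d).smul c).ofPrincipalParts_eq]

variable {C p n} in
lemma HasPrincipalParts.principalPartsToH1_eq {s : (C.wittQ p n).obj.obj (op ⊤)}
    {d : C.PrincipalParts p n} (h : C.HasPrincipalParts p n s d) :
    C.principalPartsToH1 p n d = C.connecting p n s :=
  congrArg (C.connecting p n) h.ofPrincipalParts_eq

lemma principalPartsToH1_surjective : Function.Surjective (C.principalPartsToH1 p n) := by
  intro x
  obtain ⟨s, rfl⟩ := C.connecting_surjective p n x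
  obtain ⟨d, h⟩ := exists_hasPrincipalParts_right s
  exact ⟨d, h.principalPartsToH1_eq⟩

/-- Sections and principal parts determine each other, so `connecting_eq_zero_iff` carries over to
principal parts. -/
lemma ker_principalPartsToH1 :
    LinearMap.ker (C.principalPartsToH1 p n) = LinearMap.range (C.diagPrincipalParts p n) := by
  ext d
  rw [LinearMap.mem_ker, LinearMap.mem_range]
  refine (C.connecting_eq_zero_iff p n _).trans (exists_congr fun g => ⟨fun h => ?_, fun h => ?_⟩)
  · exact (hasPrincipalParts_globalSection g).right_unique
      (h ▸ C.hasPrincipalParts_ofPrincipalParts p n d)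
  · rw [← h, (hasPrincipalParts_globalSection g).ofPrincipalParts_eq]

/-- The isomorphism between `H¹(X, 𝒲_n(𝒪_X))` and the quotient of the principal parts by the
rational functions. -/
def h1Equiv : C.H1 p n ≃ₗ[TruncatedWittVector p n k] C.PrincipalPartsQuotient p n :=
  ((Submodule.quotEquivOfEq _ _ (C.ker_principalPartsToH1 p n).symm).trans
    ((C.principalPartsToH1 p n).quotKerEquivOfSurjective
      (C.principalPartsToH1_surjective p n))).symm

lemma h1Equiv_principalPartsToH1 (d : C.PrincipalParts p n) :
    C.h1Equiv p n (C.principalPartsToH1 p n d) = Submodule.Quotient.mk d :=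
  (LinearEquiv.symm_apply_eq _).2 rfl

/-! ### The adelic description -/

lemma principalParts_surjective : Function.Surjective (C.principalParts p n) := by
  intro d
  choose g hg using fun x : closedPoints C.X => C.toLocalQuotient_surjective p n x.1 (d x)
  refine ⟨TruncatedWittVector.mk p fun i => ⟨fun x => (g x).coeff i, ?_⟩, ?_⟩
  -- Where `d` vanishes, any chosen representative lies in $W_n(\mathcal O_{X,x})$, so every Witt
  -- component is regular outside the finite support of `d`.
  · refine (C.finite_support p n d).subset fun x hx h => hx ?_
    rw [← hg, toLocalQuotient_eq_zero_iff, mem_wittSubmodule] at h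
    exact h i
  · refine DFinsupp.ext fun x => ?_
    exact (C.principalParts_apply p n _ x).trans (hg x)

lemma ker_principalParts :
    LinearMap.ker (C.principalParts p n) = wittSubmodule p n C.regularAdele := by
  ext a
  rw [LinearMap.mem_ker, mem_wittSubmodule]
  refine DFinsupp.ext_iff.trans ((forall_congr' fun x => ?_).trans forall_comm)
  refine (iff_of_eq (congrArg (· = 0) (C.principalParts_apply p n a x))).trans ?_
  exact (C.toLocalQuotient_eq_zero_iff p n x.1 _).trans (mem_wittSubmodule p n _ _)

/-- The isomorphism between the quotient of the principal parts by the rational functions and the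
adelic quotient. -/
def adelicEquiv : C.PrincipalPartsQuotient p n ≃ₗ[TruncatedWittVector p n k]
    C.AdelicQuotient p n :=
  let f := (LinearMap.range (C.diagPrincipalParts p n)).mkQ ∘ₗ C.principalParts p n
  have hf : Function.Surjective f :=
    (Submodule.mkQ_surjective _).comp (C.principalParts_surjective p n)
  -- The diagonal map to principal parts factors through `principalParts`; the preimage of an image
  -- under a linear map is the original submodule plus the kernel, here $W_n(K)+W_n(\mathbb
  -- A_X^\circ)$.
  have hker : wittSubmodule p n C.regularAdele ⊔ LinearMap.range (wittMapₗ p n C.diag) =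
      LinearMap.ker f := by
    rw [LinearMap.ker_comp, Submodule.ker_mkQ, diagPrincipalParts, LinearMap.range_comp,
      Submodule.comap_map_eq, ker_principalParts, sup_comm]
  ((Submodule.quotEquivOfEq _ _ hker).trans (f.quotKerEquivOfSurjective hf)).symm

lemma adelicEquiv_mk_principalParts (a : TruncatedWittVector p n C.Adele) :
    C.adelicEquiv p n (Submodule.Quotient.mk (C.principalParts p n a)) =
      Submodule.Quotient.mk a :=
  (LinearEquiv.symm_apply_eq _).2 rfl

end Curve

end WittCurve

end

theorem mainTheorem4 (p : ℕ) [Fact p.Prime] (k : Type u) [Field k] [IsAlgClosed k] [CharP k p]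
    (C : WittCurve.Curve k) (n : ℕ) (hn : 1 ≤ n) :
    ∃ (φ : C.H1 p n ≃ₗ[TruncatedWittVector p n k] C.PrincipalPartsQuotient p n)
      (ψ : C.PrincipalPartsQuotient p n ≃ₗ[TruncatedWittVector p n k] C.AdelicQuotient p n),
      (∀ s : (C.wittQ p n).obj.obj (op ⊤), ∃ d : C.PrincipalParts p n,
        C.HasPrincipalParts p n s d) ∧
      (∀ d : C.PrincipalParts p n, ∃ s : (C.wittQ p n).obj.obj (op ⊤),
        C.HasPrincipalParts p n s d) ∧
      (∀ (s : (C.wittQ p n).obj.obj (op ⊤)) (d : C.PrincipalParts p n),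
        C.HasPrincipalParts p n s d →
          φ (C.connecting p n s) = Submodule.Quotient.mk d) ∧
      (∀ a : TruncatedWittVector p n C.Adele,
        ψ (Submodule.Quotient.mk (C.principalParts p n a)) = Submodule.Quotient.mk a) := by
  refine ⟨C.h1Equiv p n, C.adelicEquiv p n,
    WittCurve.Curve.exists_hasPrincipalParts_right,
    WittCurve.Curve.exists_hasPrincipalParts_left, fun s d h => ?_,
    C.adelicEquiv_mk_principalParts p n⟩
  rw [← h.principalPartsToH1_eq, WittCurve.Curve.h1Equiv_principalPartsToH1]
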